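/- Let $n$ be a positive integer divisible by $4$, and let $\mathrm{Tr}$ denote the trace from $\mathbb{F}_{2^n}$ to $\mathbb{F}_2$. Call $\alpha\in\mathbb{F}_{2^n}$ a normal element of $\mathbb{F}_{2^n}$ over $\mathbb{F}_2$ if $\alpha,\alpha^{2},\alpha^{2^2},\dots,\alpha^{2^{n-1}}$ form a basis of $\mathbb{F}_{2^n}$ over $\mathbb{F}_2$, and call the vector $$\bigl(\mathrm{Tr}(\alpha^{1+2^i})\bigr)_{0\le i\le n-1}\in\mathbb{F}_2^n$$ the corresponding vector of $\alpha$ (its entry at $i=0$ is $\mathrm{Tr}(\alpha^2)=\mathrm{Tr}(\alpha)$). Then there is a normal element $\alpha$ of $\mathbb{F}_{2^n}$ over $\mathbb{F}_2$ whose corresponding vector has Hamming weight (number of nonzero entries) exactly $3$. Moreover, $3$ is the minimum possible: for every normal element $\beta$ of $\mathbb{F}_{2^n}$ over $\mathbb{F}_2$, the corresponding vector of $\beta$ has Hamming weight at least $3$. -/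

import Mathlib

/-- `α` is a normal element of `K` over the finite field `F` with `q` elements, where `K` has
degree `n` over `F`: the conjugates `α, α^q, …, α^(q^(n-1))` form a basis of `K` over `F`. -/
def IsNormalElement (F : Type*) {K : Type*} [Field F] [Field K] [Algebra F K]
    (n : ℕ) (α : K) : Prop :=
  LinearIndependent F (fun i : Fin n => α ^ (Nat.card F ^ (i : ℕ))) ∧
    Submodule.span F (Set.range (fun i : Fin n => α ^ (Nat.card F ^ (i : ℕ)))) = ⊤

/-- The vector `(Tr(α · α^(q^i)))` with `0 ≤ i ≤ n - 1`, where `Tr` is the trace from `K` to `F`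
and `q` is the number of elements of `F`. -/
noncomputable def correspondingVector (F : Type*) {K : Type*} [Field F] [Field K] [Algebra F K]
    (n : ℕ) (α : K) : Fin n → F :=
  fun i => Algebra.trace F K (α * α ^ (Nat.card F ^ (i : ℕ)))

/-!
Let `G` be the Galois group of `K` over `F = 𝔽₂` and encode the corresponding vector of `a` as the
element `A a = ∑ σ, Tr (a * σ a) σ` of the group algebra of `G`, its autocorrelation. It is fixed
by the antipode `f ↦ f*`, it is a unit when `a` is normal and only then, and replacing `a` by
`f • a` multiplies it by the norm `f * f*`. So the question is which symmetric units agree up to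
norms.

If `[K : F]` is odd, squaring is a bijection on the group algebra, so every symmetric unit is a
norm and `A a = 1` for some `a`. If `[K : F] = 2 ^ k` with `k ≥ 2` and `σ` generates `G`, then
`t = σ + σ⁻¹` is nilpotent, and `A a` is a polynomial in `t` because its coefficients at the
involution vanish. The norm of `1 + t` is `1 + t ^ 2`, and that of `1 + t ^ (j - 1) * σ` is
`1 + t ^ j + t ^ (2 * j - 2)`, so multiplying by norms successively corrects all coefficients of
degree at least `2`. Those of degree `0` and `1` are seen in the subfield of degree `4`, to which
`A` descends through the relative trace; they are both `1` when `Tr a = 1`. Hence `A a = 1 + t` for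
some `a`. In general `K` is the compositum of two such fields, and the product of the two elements
just found has an autocorrelation `1 + τ + τ⁻¹` of weight `3`.

The subfield of degree `4` gives the lower bound as well: if `Tr b ≠ 0`, then `A b` has a nonzero
coefficient at some `σ` with `σ ^ 2 ≠ 1`, hence also at `σ⁻¹`, besides the one at `1`.
-/

open Finset MonoidAlgebra Polynomial
open HopfAlgebra (antipode)

section GroupPairing

variable {F G V : Type*} [CommRing F] [Group G] [AddCommGroup V] [Module F V]

lemma asAlgebraHom_apply_eq_linearCombination (ρ : Representation F G V) (f : MonoidAlgebra F G)
    (x : V) : ρ.asAlgebraHom f x = Finsupp.linearCombination F (fun g => ρ g x) f.coeff := by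
  induction f using MonoidAlgebra.induction_linear with
  | zero => simp
  | add f₁ f₂ h₁ h₂ => simp [h₁, h₂]
  | single g c => simp

variable [Fintype G]

/-- The pairing with values in the group algebra attached to a bilinear form `B` on a
representation `ρ`: it collects the values `B x (ρ g y)` for all `g`. For invariant `B` it is
sesquilinear over the group algebra, with the antipode as conjugation. -/
noncomputable def groupPairing (ρ : Representation F G V) (B : LinearMap.BilinForm F V) (x y : V) :
    MonoidAlgebra F G :=
  ∑ g, single g (B x (ρ g y))

variable (ρ : Representation F G V) (B : LinearMap.BilinForm F V)

@[simp]
lemma coeff_groupPairing (x y : V) (g : G) : (groupPairing ρ B x y).coeff g = B x (ρ g y) := by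
  classical
  simp [groupPairing, MonoidAlgebra.coeff_sum, Finsupp.single_apply]

lemma groupPairing_asAlgebraHom_right (f : MonoidAlgebra F G) (x y : V) :
    groupPairing ρ B x (ρ.asAlgebraHom f y) = groupPairing ρ B x y * antipode F f := by
  induction f using MonoidAlgebra.induction_linear with
  | zero => ext; simp
  | add f₁ f₂ h₁ h₂ => rw [map_add, map_add, mul_add, ← h₁, ← h₂]; ext; simp
  | single h c => ext g; simp [coeff_mul_single_apply, mul_comm]

variable {ρ B} (hB : ∀ g x y, B (ρ g x) (ρ g y) = B x y)

include hB

lemma groupPairing_asAlgebraHom_left (f : MonoidAlgebra F G) (x y : V) :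
    groupPairing ρ B (ρ.asAlgebraHom f x) y = f * groupPairing ρ B x y := by
  induction f using MonoidAlgebra.induction_linear with
  | zero => ext; simp
  | add f₁ f₂ h₁ h₂ => rw [map_add, add_mul, ← h₁, ← h₂]; ext; simp
  | single h c =>
    ext g
    rw [coeff_groupPairing, coeff_single_mul_apply, coeff_groupPairing, ← hB h⁻¹]
    simp [← Module.End.mul_apply, ← map_mul]

lemma antipode_groupPairing (hs : B.IsSymm) (x y : V) :
    antipode F (groupPairing ρ B x y) = groupPairing ρ B y x := by
  have hinv (g : G) : B x (ρ g y) = B y (ρ g⁻¹ x) := by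
    rw [hs.eq, ← hB g⁻¹, ← Module.End.mul_apply, ← map_mul]
    simp
  simp only [groupPairing, hinv, map_sum, antipode_single, CommSemiring.antipode_eq_id,
    LinearMap.id_apply]
  exact Equiv.sum_comp (Equiv.inv G) fun g => single g (B y (ρ g x))

lemma linearIndependent_of_isUnit_groupPairing {x y : V} (h : IsUnit (groupPairing ρ B x y)) :
    LinearIndependent F fun g => ρ g x := by
  rw [linearIndependent_iff]
  intro l hl
  have hx : ρ.asAlgebraHom (ofCoeff l) x = 0 := by
    rwa [asAlgebraHom_apply_eq_linearCombination]
  have hzero : ofCoeff l * groupPairing ρ B x y = 0 := by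
    rw [← groupPairing_asAlgebraHom_left hB, hx]; ext; simp
  exact ofCoeff_eq_zero.1 (h.mul_left_eq_zero.1 hzero)

end GroupPairing

lemma isUnit_groupPairing_of_basis {F G V : Type*} [Field F] [Group G] [Fintype G]
    [AddCommGroup V] [Module F V] {ρ : Representation F G V} {B : LinearMap.BilinForm F V}
    (hB : ∀ g x y, B (ρ g x) (ρ g y) = B x y) (hs : B.IsSymm) (hnd : B.Nondegenerate)
    (b : Module.Basis G F V) {x : V} (hb : ∀ g, b g = ρ g x) :
    IsUnit (groupPairing ρ B x x) := by
  classical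
  let y := B.dualBasis hnd b 1
  obtain ⟨f, hf⟩ : ∃ f : MonoidAlgebra F G, ρ.asAlgebraHom f x = y :=
    ⟨ofCoeff (b.repr y), by simp [asAlgebraHom_apply_eq_linearCombination, ← hb]⟩
  have hyx : groupPairing ρ B y x = 1 := by
    ext g
    rw [coeff_groupPairing, ← hb, LinearMap.BilinForm.apply_dualBasis_left]
    simp [one_def, Finsupp.single_apply, eq_comm]
  have hxy : groupPairing ρ B x y = 1 := by
    rw [← antipode_groupPairing hB hs, hyx]
    simp
  refine isUnit_iff_exists_and_exists.2 ⟨⟨antipode F f, ?_⟩, ⟨f, ?_⟩⟩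
  · rw [← groupPairing_asAlgebraHom_right, hf, hxy]
  · rw [← groupPairing_asAlgebraHom_left hB, hf, hyx]

section Autocorrelation

/-- The natural representation of the Galois group of `K` over `F` on `K`. -/
noncomputable abbrev galoisRepresentation (F K : Type*) [Field F] [Field K] [Algebra F K] :
    Representation F Gal(K/F) K :=
  Representation.ofDistribMulAction F Gal(K/F) K

variable {F K : Type*} [Field F] [Field K] [Algebra F K]

lemma traceForm_galoisRepresentation (σ : Gal(K/F)) (x y : K) :
    Algebra.traceForm F K (galoisRepresentation F K σ x) (galoisRepresentation F K σ y) =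
      Algebra.traceForm F K x y := by
  simp [Algebra.traceForm_apply, ← map_mul, Algebra.trace_eq_of_algEquiv]

/-- The element of the group algebra of the Galois group whose coefficient at `σ` is the trace of
`a * σ a`. For a finite field it encodes the corresponding vector of `a`. -/
noncomputable def autocorrelation (F : Type*) {K : Type*} [Field F] [Field K] [Algebra F K]
    [FiniteDimensional F K] (a : K) : MonoidAlgebra F Gal(K/F) :=
  groupPairing (galoisRepresentation F K) (Algebra.traceForm F K) a a

variable [FiniteDimensional F K]

@[simp]
lemma coeff_autocorrelation (a : K) (σ : Gal(K/F)) :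
    (autocorrelation F a).coeff σ = Algebra.trace F K (a * σ a) := by
  simp [autocorrelation]

lemma antipode_autocorrelation (a : K) : antipode F (autocorrelation F a) = autocorrelation F a :=
  antipode_groupPairing traceForm_galoisRepresentation (Algebra.traceForm_isSymm F) a a

lemma exists_autocorrelation_eq_mul (f : MonoidAlgebra F Gal(K/F)) (a : K) :
    ∃ b : K, autocorrelation F b = f * autocorrelation F a * antipode F f :=
  ⟨(galoisRepresentation F K).asAlgebraHom f a, by
    rw [autocorrelation, groupPairing_asAlgebraHom_right,
      groupPairing_asAlgebraHom_left traceForm_galoisRepresentation, autocorrelation]⟩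

lemma linearIndependent_conj_of_isUnit_autocorrelation {a : K}
    (ha : IsUnit (autocorrelation F a)) : LinearIndependent F fun σ : Gal(K/F) => σ a :=
  linearIndependent_of_isUnit_groupPairing traceForm_galoisRepresentation ha

lemma exists_isUnit_autocorrelation (F K : Type*) [Field F] [Field K] [Algebra F K]
    [FiniteDimensional F K] [IsGalois F K] : ∃ a : K, IsUnit (autocorrelation F a) :=
  ⟨IsGalois.normalBasis F K 1,
    isUnit_groupPairing_of_basis traceForm_galoisRepresentation (Algebra.traceForm_isSymm F)
      (traceForm_nondegenerate F K) (IsGalois.normalBasis F K) IsGalois.normalBasis_apply⟩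

end Autocorrelation

section LinearDisjoint

variable {F K : Type*} [Field F] [Field K] [Algebra F K] {A B : IntermediateField F K}

variable [Normal F A] [Normal F B] in
lemma injective_restrictNormalHom_prod (hAB : A ⊔ B = ⊤) :
    Function.Injective ((AlgEquiv.restrictNormalHom A).prod (AlgEquiv.restrictNormalHom B) :
      Gal(K/F) →* Gal(A/F) × Gal(B/F)) := by
  rw [← MonoidHom.ker_eq_bot_iff, MonoidHom.ker_prod, IntermediateField.restrictNormalHom_ker,
    IntermediateField.restrictNormalHom_ker, ← IntermediateField.fixingSubgroup_sup, hAB,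
    IntermediateField.fixingSubgroup_top]

variable [FiniteDimensional F K]

lemma trace_coe_mul_coe (h : A.LinearDisjoint B) (hAB : A ⊔ B = ⊤) (x : A) (y : B) :
    Algebra.trace F K (x * y) = Algebra.trace F A x * Algebra.trace F B y := by
  rw [← Algebra.trace_trace (S := A)]
  have : Algebra.trace A K (x * y) = x * algebraMap F A (Algebra.trace F B y) := by
    rw [← h.trace_algebraMap hAB]
    exact map_smul (Algebra.trace A K) x (y : K)
  rw [this, mul_comm, ← Algebra.smul_def, map_smul, smul_eq_mul, mul_comm]

variable [Normal F A] [Normal F B]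

lemma coeff_autocorrelation_coe_mul_coe (h : A.LinearDisjoint B) (hAB : A ⊔ B = ⊤) (c : A) (d : B)
    (τ : Gal(K/F)) : (autocorrelation F (c * d : K)).coeff τ =
      (autocorrelation F c).coeff (AlgEquiv.restrictNormalHom A τ) *
        (autocorrelation F d).coeff (AlgEquiv.restrictNormalHom B τ) := by
  rw [coeff_autocorrelation, coeff_autocorrelation, coeff_autocorrelation,
    ← trace_coe_mul_coe h hAB]
  congr 1
  simp only [MulMemClass.coe_mul, AlgEquiv.restrictNormalHom_apply, map_mul]
  ring

lemma surjective_restrictNormalHom_prod [IsGalois F K] (h : A.LinearDisjoint B) (hAB : A ⊔ B = ⊤) :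
    Function.Surjective ((AlgEquiv.restrictNormalHom A).prod (AlgEquiv.restrictNormalHom B) :
      Gal(K/F) →* Gal(A/F) × Gal(B/F)) := by
  have : IsGalois F A := {}
  have : IsGalois F B := {}
  refine ((injective_restrictNormalHom_prod hAB).bijective_of_nat_card_le ?_).2
  rw [Nat.card_prod, IsGalois.card_aut_eq_finrank, IsGalois.card_aut_eq_finrank,
    IsGalois.card_aut_eq_finrank, ← h.finrank_sup, hAB, IntermediateField.finrank_top']

lemma autocorrelation_coe_mul_coe_eq (h : A.LinearDisjoint B) (hAB : A ⊔ B = ⊤) {c : A} {d : B}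
    (hc : autocorrelation F c = 1) {τ : Gal(K/F)} (hτA : AlgEquiv.restrictNormalHom A τ = 1)
    (hd : autocorrelation F d = 1 + (of F _ (AlgEquiv.restrictNormalHom B τ) +
      of F _ (AlgEquiv.restrictNormalHom B τ)⁻¹)) :
    autocorrelation F (c * d : K) = 1 + (of F _ τ + of F _ τ⁻¹) := by
  classical
  ext σ
  have hσ (ρ : Gal(K/F)) : ρ = σ ↔
      AlgEquiv.restrictNormalHom A ρ = AlgEquiv.restrictNormalHom A σ ∧
        AlgEquiv.restrictNormalHom B ρ = AlgEquiv.restrictNormalHom B σ := by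
    rw [← (injective_restrictNormalHom_prod hAB).eq_iff]; exact Prod.ext_iff
  rw [coeff_autocorrelation_coe_mul_coe h hAB, hc, hd]
  by_cases hA : 1 = AlgEquiv.restrictNormalHom A σ
  · simp [one_def, Finsupp.single_apply, hσ, hτA, ← hA]
  · simp [one_def, Finsupp.single_apply, hσ, hτA, hA]

end LinearDisjoint

section RelativeTrace

variable {F K : Type*} [Field F] [Field K] [Algebra F K] [FiniteDimensional F K] [IsGalois F K]
  {E : IntermediateField F K} [Normal F E]

lemma sum_conj_of_restrictNormalHom_eq [DecidableEq Gal(E/F)] (τ : Gal(E/F)) (a : K) :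
    ∑ σ : Gal(K/F) with AlgEquiv.restrictNormalHom E σ = τ, σ a = τ (Algebra.trace E K a) := by
  obtain ⟨σ₀, rfl⟩ := AlgEquiv.restrictNormalHom_surjective K τ
  rw [AlgEquiv.restrictNormalHom_apply, ← IntermediateField.algebraMap_apply,
    trace_eq_sum_automorphisms, map_sum]
  symm
  refine Finset.sum_bij (fun ρ _ => σ₀ * (E.fixingSubgroupEquiv.symm ρ : Gal(K/F))) ?_ ?_ ?_ ?_
  · intro ρ _
    have hρ : AlgEquiv.restrictNormalHom E (E.fixingSubgroupEquiv.symm ρ : Gal(K/F)) = 1 := by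
      rw [← MonoidHom.mem_ker, IntermediateField.restrictNormalHom_ker]
      exact SetLike.coe_mem _
    simp [hρ]
  · intro ρ _ ρ' _ h
    simpa using h
  · intro σ hσ
    have hmem : σ₀⁻¹ * σ ∈ E.fixingSubgroup := by
      rw [← IntermediateField.restrictNormalHom_ker, MonoidHom.mem_ker, map_mul, map_inv,
        (mem_filter.1 hσ).2, inv_mul_cancel]
    exact ⟨E.fixingSubgroupEquiv ⟨_, hmem⟩, mem_univ _, by simp⟩
  · intro ρ _
    rfl

lemma mapDomain_restrictNormalHom_autocorrelation (E : IntermediateField F K) [Normal F E] (a : K) :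
    mapDomain (AlgEquiv.restrictNormalHom E) (autocorrelation F a) =
      autocorrelation F (Algebra.trace E K a) := by
  classical
  ext τ
  have hE : Algebra.trace E K (a * (τ (Algebra.trace E K a) : E)) =
      Algebra.trace E K a * τ (Algebra.trace E K a) := by
    rw [mul_comm a, mul_comm (Algebra.trace E K a)]
    exact map_smul (Algebra.trace E K) (τ (Algebra.trace E K a)) a
  rw [coeff_autocorrelation, ← hE, Algebra.trace_trace, ← sum_conj_of_restrictNormalHom_eq,
    mul_sum, map_sum, autocorrelation, groupPairing]
  simp [mapDomain, Finsupp.mapDomain_finsetSum, Finsupp.single_apply, sum_filter]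

end RelativeTrace

section TraceMulConj

variable {F K : Type*} [Field F] [Field K] [Algebra F K] [FiniteDimensional F K] [IsGalois F K]

lemma trace_eq_sum_conj_of_orderOf_eq_four (hK : Module.finrank F K = 4) {τ : Gal(K/F)}
    (hτ : orderOf τ = 4) (x : K) :
    algebraMap F K (Algebra.trace F K x) = x + τ x + τ (τ x) + τ (τ (τ x)) := by
  have hinj : Function.Injective fun i : Fin 4 => τ ^ (i : ℕ) := fun i j h =>
    Fin.ext (pow_injOn_Iio_orderOf (by simp [hτ]) (by simp [hτ]) h)
  have hbij := hinj.bijective_of_nat_card_le (by rw [IsGalois.card_aut_eq_finrank, hK]; simp)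
  rw [trace_eq_sum_automorphisms, ← hbij.sum_comp, Fin.sum_univ_four]
  simp [pow_succ]

lemma trace_mul_conj_ne_zero (hK : Module.finrank F K = 4) {τ : Gal(K/F)} (hτ : orderOf τ = 4)
    {b : K} (hb : Algebra.trace F K b ≠ 0) : Algebra.trace F K (b * τ b) ≠ 0 := by
  have hτ4 : τ (τ (τ (τ b))) = b := by
    have : (τ ^ 4) b = b := by rw [← hτ, pow_orderOf_eq_one, AlgEquiv.one_apply]
    simpa [pow_succ] using this
  -- `u` is the trace of `b` to the quadratic subfield, so `u * τ u` is a norm.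
  let u := b + τ (τ b)
  have hsum : algebraMap F K (Algebra.trace F K b) = u + τ u := by
    rw [trace_eq_sum_conj_of_orderOf_eq_four hK hτ, map_add]; ring
  have hmul : algebraMap F K (Algebra.trace F K (b * τ b)) = u * τ u := by
    simp only [trace_eq_sum_conj_of_orderOf_eq_four hK hτ, u, map_add, map_mul, hτ4]
    ring
  intro h
  have hu : u = 0 := by simpa [h] using hmul
  exact hb (by simpa [hu] using hsum)

variable [CharP F 2]

lemma trace_mul_self (a : K) : Algebra.trace F K (a * a) = Algebra.trace F K a ^ 2 := by
  have := charP_of_injective_algebraMap (algebraMap F K).injective 2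
  apply (algebraMap F K).injective
  simp [trace_eq_sum_automorphisms, ← pow_two, sum_pow_char]

lemma trace_mul_conj_eq_zero {σ : Gal(K/F)} (hσ : σ ≠ 1) (hσ2 : σ * σ = 1) (a : K) :
    Algebra.trace F K (a * σ a) = 0 := by
  have := charP_of_injective_algebraMap (algebraMap F K).injective 2
  apply (algebraMap F K).injective
  rw [trace_eq_sum_automorphisms, map_zero]
  refine Finset.sum_involution (fun ρ _ => ρ * σ) (fun ρ _ => ?_)
    (fun _ _ _ => by simpa using hσ) (by simp) (by simp [mul_assoc, hσ2])
  have hinv : σ (σ a) = a := by rw [← AlgEquiv.mul_apply, hσ2, AlgEquiv.one_apply]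
  rw [AlgEquiv.mul_apply, map_mul σ, hinv, mul_comm, CharTwo.add_self_eq_zero]

end TraceMulConj

section AntipodeInvariant

variable {F G : Type*} [CommRing F]

lemma coeff_antipode [Group G] (f : MonoidAlgebra F G) (g : G) :
    (antipode F f).coeff g = f.coeff g⁻¹ := by
  classical
  induction f using MonoidAlgebra.induction_linear with
  | zero => simp
  | add f₁ f₂ h₁ h₂ => simp [h₁, h₂]
  | single h c => simp [Finsupp.single_apply, inv_eq_iff_eq_inv]

lemma mem_of_antipode_eq_self [Group G] {S : Submodule F (MonoidAlgebra F G)} (h1 : 1 ∈ S)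
    (hS : ∀ g, of F G g + of F G g⁻¹ ∈ S) {f : MonoidAlgebra F G} (hf : antipode F f = f)
    (hinv : ∀ g ≠ 1, g * g = 1 → f.coeff g = 0) : f ∈ S := by
  have hsymm (g : G) : f.coeff g⁻¹ = f.coeff g := by rw [← coeff_antipode, hf]
  rw [← Submodule.Quotient.mk_eq_zero, ← sum_coeff_single f, Finsupp.sum, ← S.mkQ_apply, map_sum]
  refine Finset.sum_involution (fun g _ => g⁻¹) (fun g _ => ?_) (fun g _ hne hg => ?_)
    (fun g hg => ?_) (fun g _ => inv_inv g)
  · have hpair : single g (f.coeff g) + single g⁻¹ (f.coeff g⁻¹) =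
        f.coeff g • (of F G g + of F G g⁻¹) := by simp [hsymm]
    rw [← map_add, hpair, S.mkQ_apply, Submodule.Quotient.mk_eq_zero]
    exact S.smul_mem _ (hS g)
  · refine hne ?_
    rw [S.mkQ_apply, Submodule.Quotient.mk_eq_zero]
    by_cases h : g = 1
    · simpa [h, one_def] using S.smul_mem (f.coeff 1) h1
    · simp [hinv g h (by rwa [mul_eq_one_iff_inv_eq])]
  · simpa [hsymm] using hg

variable [CommGroup G]

lemma of_pow_add_of_pow_inv_mem_adjoin (g : G) (n : ℕ) :
    of F G (g ^ n) + of F G (g ^ n)⁻¹ ∈ Algebra.adjoin F {of F G g + of F G g⁻¹} := by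
  have h := dickson_one_one_eval_add_inv (of F G g) (of F G g⁻¹)
    (by rw [← map_mul, mul_inv_cancel, map_one]) n
  rw [← inv_pow, map_pow, map_pow, ← h, ← map_one (algebraMap F (MonoidAlgebra F G)),
    ← map_dickson, eval_map_algebraMap]
  exact aeval_mem_adjoin_singleton _ _

lemma mem_adjoin_of_antipode_eq_self {g : G} (hg : ∀ x, x ∈ Subgroup.zpowers g)
    {f : MonoidAlgebra F G} (hf : antipode F f = f)
    (hinv : ∀ g ≠ 1, g * g = 1 → f.coeff g = 0) :
    f ∈ Algebra.adjoin F {of F G g + of F G g⁻¹} := by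
  refine mem_of_antipode_eq_self
    (S := Subalgebra.toSubmodule (Algebra.adjoin F {of F G g + of F G g⁻¹}))
    (one_mem (Algebra.adjoin F _)) (fun x => ?_) hf hinv
  obtain ⟨j, rfl⟩ := hg x
  obtain ⟨n, rfl | rfl⟩ := j.eq_nat_or_neg
  · simpa using of_pow_add_of_pow_inv_mem_adjoin g n
  · simpa [add_comm] using of_pow_add_of_pow_inv_mem_adjoin g n

end AntipodeInvariant

section AntipodeNorm

/-- The multiplicative map `f ↦ f * antipode f` on a commutative Hopf algebra. On the group algebra
of the Galois group its values are the factors by which an autocorrelation can be changed, see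
`exists_autocorrelation_eq_mul`. -/
noncomputable def antipodeNorm (R A : Type*) [CommSemiring R] [CommSemiring A] [HopfAlgebra R A] :
    A →* A :=
  MonoidHom.id A * (HopfAlgebra.antipodeAlgHom R A : A →* A)

variable {R A : Type*} [CommSemiring R] [CommSemiring A] [HopfAlgebra R A]

lemma antipodeNorm_apply (f : A) : antipodeNorm R A f = f * antipode R f := rfl

lemma antipodeNorm_of_antipode_eq {f : A} (hf : antipode R f = f) : antipodeNorm R A f = f ^ 2 := by
  rw [antipodeNorm_apply, hf, pow_two]

lemma antipode_pow_of_antipode_eq {f : A} (hf : antipode R f = f) (n : ℕ) :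
    antipode R (f ^ n) = f ^ n := by
  simpa [hf] using map_pow (HopfAlgebra.antipodeAlgHom R A) f n

end AntipodeNorm

lemma exists_mem_X_pow_dvd_mul_sub {M : Submonoid (ZMod 2)[X]}
    (hM : ∀ k ≥ 2, ∃ N ∈ M, X ^ (k + 1) ∣ N - (1 + X ^ k)) {P Q : (ZMod 2)[X]}
    (hPQ : X ^ 2 ∣ P - Q) (hQ : Q.coeff 0 = 1) (k : ℕ) :
    ∃ N ∈ M, X ^ (k + 2) ∣ N * P - Q := by
  induction k with
  | zero => exact ⟨1, M.one_mem, by simpa using hPQ⟩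
  | succ k ih =>
    obtain ⟨N, hN, R, hR⟩ := ih
    by_cases hR0 : R.coeff 0 = 0
    · exact ⟨N, hN, by rw [hR, pow_succ X (k + 2)]; exact mul_dvd_mul_left _ (X_dvd_iff.2 hR0)⟩
    · have hR1 : R.coeff 0 = 1 := Fin.eq_one_of_ne_zero _ hR0
      obtain ⟨N', hN', S, hS⟩ := hM (k + 2) (by lia)
      obtain ⟨T, hT⟩ : X ∣ Q + R := by
        rw [X_dvd_iff, Polynomial.coeff_add, hQ, hR1, CharTwo.add_self_eq_zero]
      refine ⟨N' * N, M.mul_mem hN' hN, T + X ^ (k + 1) * R + S * (N * P), ?_⟩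
      linear_combination (N * P) * hS + (1 + X ^ (k + 2)) * hR + X ^ (k + 2) * hT

section GroupAlgebraCharTwo

instance charP_monoidAlgebra (R M : Type*) [CommRing R] [Monoid M] (p : ℕ) [CharP R p] :
    CharP (MonoidAlgebra R M) p :=
  charP_of_injective_ringHom (f := (singleOneRingHom : R →+* MonoidAlgebra R M))
    (single_right_injective (m := 1)) p

variable {F G : Type*} [CommRing F] [CharP F 2] [Group G] {g : G} {k : ℕ}

lemma of_add_of_inv_pow_two_pow_eq_zero (hg : g ^ 2 ^ k = 1) :
    (of F G g + of F G g⁻¹) ^ 2 ^ k = 0 := by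
  have hcomm : Commute (of F G g) (of F G g⁻¹) := (Commute.refl g).inv_right.map (of F G)
  rw [add_pow_char_pow_of_commute _ _ hcomm, ← map_pow, ← map_pow, inv_pow, hg, inv_one,
    CharTwo.add_self_eq_zero]

lemma isUnit_one_add_of_add_of_inv (hg : g ^ 2 ^ k = 1) :
    IsUnit (1 + (of F G g + of F G g⁻¹)) :=
  IsNilpotent.isUnit_one_add ⟨_, of_add_of_inv_pow_two_pow_eq_zero hg⟩

end GroupAlgebraCharTwo

section CommGroupAlgebraCharTwo

variable {G : Type*} [CommGroup G]

lemma exists_antipodeNorm_eq_aeval (g : G) {k : ℕ} (hk : 2 ≤ k) :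
    ∃ N : (ZMod 2)[X], (∃ f, antipodeNorm (ZMod 2) (MonoidAlgebra (ZMod 2) G) f =
      aeval (of (ZMod 2) G g + of (ZMod 2) G g⁻¹) N) ∧ X ^ (k + 1) ∣ N - (1 + X ^ k) := by
  set t := of (ZMod 2) G g + of (ZMod 2) G g⁻¹ with ht
  have hsymm : antipode (ZMod 2) t = t := by simp [ht, add_comm]
  obtain rfl | hk := hk.eq_or_lt
  · refine ⟨1 + X ^ 2, ⟨1 + t, ?_⟩, by simp⟩
    rw [antipodeNorm_of_antipode_eq (by simp [hsymm]), CharTwo.add_sq]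
    simp
  · obtain ⟨j, rfl⟩ := Nat.exists_eq_add_of_lt hk
    refine ⟨1 + X ^ (j + 3) + X ^ (2 * j + 4), ⟨1 + t ^ (j + 2) * of (ZMod 2) G g, ?_⟩, ?_⟩
    · have hmul : of (ZMod 2) G g * of (ZMod 2) G g⁻¹ = 1 := by
        rw [← map_mul, mul_inv_cancel, map_one]
      have hanti : antipode (ZMod 2) (1 + t ^ (j + 2) * of (ZMod 2) G g) =
          1 + t ^ (j + 2) * of (ZMod 2) G g⁻¹ := by
        simp [HopfAlgebra.antipode_mul_distrib, antipode_pow_of_antipode_eq hsymm]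
      rw [antipodeNorm_apply, hanti]
      simp only [map_add, map_one, map_pow, aeval_X]
      linear_combination t ^ (2 * j + 4) * hmul - t ^ (j + 2) * ht
    · exact ⟨X ^ j, by ring⟩

lemma exists_antipodeNorm_mul_aeval_eq {g : G} {k : ℕ} (hg : g ^ 2 ^ k = 1) {P : (ZMod 2)[X]}
    (hP : X ^ 2 ∣ P - (1 + X)) :
    ∃ f, antipodeNorm (ZMod 2) _ f * aeval (of (ZMod 2) G g + of (ZMod 2) G g⁻¹) P =
      1 + (of (ZMod 2) G g + of (ZMod 2) G g⁻¹) := by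
  set t := of (ZMod 2) G g + of (ZMod 2) G g⁻¹
  let M := (MonoidHom.mrange (antipodeNorm (ZMod 2) (MonoidAlgebra (ZMod 2) G))).comap
    (aeval (R := ZMod 2) t : (ZMod 2)[X] →* MonoidAlgebra (ZMod 2) G)
  obtain ⟨N, ⟨f, hf⟩, R, hR⟩ := exists_mem_X_pow_dvd_mul_sub (M := M)
    (fun k hk => exists_antipodeNorm_eq_aeval g hk) hP (by simp) (2 ^ k)
  have hR' := congrArg (aeval t) hR
  simp only [map_sub, map_mul, map_pow, aeval_X, map_add, map_one, pow_add t,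
    of_add_of_inv_pow_two_pow_eq_zero hg, zero_mul, t] at hR'
  exact ⟨f, by rw [hf]; exact sub_eq_zero.1 hR'⟩

lemma pow_two_pow_totient_card_eq_self (hG : Odd (Nat.card G))
    (f : MonoidAlgebra (ZMod 2) G) : f ^ 2 ^ (Nat.card G).totient = f := by
  have hpow (g : G) : g ^ 2 ^ (Nat.card G).totient = g := by
    rw [← pow_mod_natCard g, Nat.ModEq.pow_totient (Nat.coprime_two_left.2 hG),
      pow_mod_natCard, pow_one]
  induction f using MonoidAlgebra.induction_linear with
  | zero => simp
  | add f₁ f₂ h₁ h₂ => rw [add_pow_char_pow, h₁, h₂]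
  | single g c => rw [single_pow, hpow, ZMod.pow_card_pow]

lemma exists_antipodeNorm_mul_eq_one (hG : Odd (Nat.card G))
    {u : MonoidAlgebra (ZMod 2) G} (hu : IsUnit u) (hsymm : antipode (ZMod 2) u = u) :
    ∃ f, antipodeNorm (ZMod 2) _ f * u = 1 := by
  -- `u` has odd order, so its inverse is the square of a power of `u`.
  obtain ⟨m, hm⟩ := Nat.exists_eq_succ_of_ne_zero (Nat.totient_pos.2 hG.pos).ne'
  obtain ⟨j, hj⟩ := Nat.exists_eq_succ_of_ne_zero (pow_pos two_pos m).ne'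
  have hu1 : u * u ^ (2 * j + 1) = u * 1 := by
    have hexp : 2 * j + 1 + 1 = 2 ^ (Nat.card G).totient := by rw [hm]; lia
    rw [mul_one, ← pow_succ', hexp, pow_two_pow_totient_card_eq_self hG]
  exact ⟨u ^ j, by
    rw [antipodeNorm_of_antipode_eq (antipode_pow_of_antipode_eq hsymm j), ← pow_mul, ← pow_succ,
      mul_comm j]
    exact hu.mul_left_cancel hu1⟩

lemma aeval_of_add_of_inv_of_orderOf_eq_four {F : Type*} [CommRing F] [CharP F 2] {g : G}
    (hg : orderOf g = 4) (P : F[X]) :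
    aeval (of F G g + of F G g⁻¹) P =
      algebraMap F _ (P.coeff 0) + P.coeff 1 • (of F G g + of F G g⁻¹) := by
  have hinv : g⁻¹ ^ 2 = g ^ 2 := by
    rw [inv_pow, inv_eq_iff_mul_eq_one, ← pow_add, show 2 + 2 = orderOf g from hg.symm,
      pow_orderOf_eq_one]
  have hsq : (of F G g + of F G g⁻¹) ^ 2 = 0 := by
    rw [CharTwo.add_sq, ← map_pow, ← map_pow, hinv, CharTwo.add_self_eq_zero]
  have h := aeval_add_of_sq_eq_zero P 0 _ hsq
  rwa [zero_add, ← coeff_zero_eq_aeval_zero', ← coeff_zero_eq_aeval_zero', coeff_derivative,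
    zero_add, Nat.cast_zero, zero_add, mul_one, ← Algebra.smul_def] at h

end CommGroupAlgebraCharTwo

section OneAddOfAddOfInv

variable {G : Type*} [Group G] {g : G}

lemma card_one_self_inv [DecidableEq G] (hg : g ^ 2 ≠ 1) : #{1, g, g⁻¹} = 3 := by
  have hg1 : g ≠ 1 := by rintro rfl; simp at hg
  refine card_eq_three.2 ⟨1, g, g⁻¹, hg1.symm, by simpa [eq_comm] using hg1, fun h => hg ?_, rfl⟩
  rw [pow_two, mul_eq_one_iff_eq_inv]
  exact h

lemma card_support_one_add_of_add_of_inv {F : Type*} [Semiring F] [Nontrivial F]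
    (hg : g ^ 2 ≠ 1) : #(1 + (of F G g + of F G g⁻¹)).coeff.support = 3 := by
  classical
  have hg1 : g ≠ 1 := by rintro rfl; simp at hg
  have hinv : g ≠ g⁻¹ := fun h => hg (by rwa [pow_two, mul_eq_one_iff_eq_inv])
  have hinv1 : g⁻¹ ≠ 1 := by simpa using hg1
  rw [← card_one_self_inv hg]
  congr 1
  ext h
  simp only [one_def, of_apply, MonoidAlgebra.coeff_add, coeff_single, Finsupp.mem_support_iff,
    Finsupp.add_apply, Finsupp.single_apply, mem_insert, mem_singleton]
  grind [one_ne_zero (α := F)]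

end OneAddOfAddOfInv

section CyclicExtension

variable {F K : Type*} [Field F] [Field K] [Algebra F K] [FiniteDimensional F K] [IsGalois F K]

lemma orderOf_restrictNormalHom_of_forall_mem_zpowers {E : IntermediateField F K} [Normal F E]
    {σ : Gal(K/F)} (hσ : ∀ τ, τ ∈ Subgroup.zpowers σ) :
    orderOf (AlgEquiv.restrictNormalHom E σ) = Module.finrank F E := by
  have : IsGalois F E := {}
  rw [← IsGalois.card_aut_eq_finrank]
  refine orderOf_eq_card_of_forall_mem_zpowers fun ρ => ?_
  obtain ⟨τ, rfl⟩ := AlgEquiv.restrictNormalHom_surjective K ρ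
  obtain ⟨j, rfl⟩ := hσ τ
  exact ⟨j, (map_zpow _ _ _).symm⟩

variable [IsCyclic Gal(K/F)]

lemma exists_intermediateField_finrank_eq {d : ℕ} (hd : d ∣ Module.finrank F K) :
    ∃ E : IntermediateField F K, Module.finrank F E = d := by
  obtain ⟨e, he⟩ := hd
  obtain ⟨σ, hσ⟩ := IsCyclic.exists_ofOrder_eq_natCard (α := Gal(K/F))
  rw [IsGalois.card_aut_eq_finrank, he] at hσ
  have hde : 0 < d * e := he ▸ Module.finrank_pos
  have hd0 : 0 < d := Nat.pos_of_mul_pos_right hde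
  let E := IntermediateField.fixedField (Subgroup.zpowers (σ ^ d))
  have hE : Module.finrank E K = e := by
    rw [IntermediateField.finrank_fixedField_eq_card, Nat.card_zpowers,
      orderOf_pow_of_dvd hd0.ne' ⟨e, hσ⟩, hσ, Nat.mul_div_cancel_left _ hd0]
  refine ⟨E, Nat.eq_of_mul_eq_mul_right (Nat.pos_of_mul_pos_left hde) ?_⟩
  rw [← he, ← Module.finrank_mul_finrank F E K, hE]

lemma three_le_card_support_autocorrelation [CharP F 2] (h4 : 4 ∣ Module.finrank F K) {a : K}
    (ha : Algebra.trace F K a ≠ 0) : 3 ≤ #(autocorrelation F a).coeff.support := by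
  classical
  have := IsAbelianGalois.of_isCyclic F K
  obtain ⟨E, hE⟩ := exists_intermediateField_finrank_eq h4
  obtain ⟨σ₀, hσ₀⟩ := IsCyclic.exists_generator (α := Gal(K/F))
  have hτ : orderOf (AlgEquiv.restrictNormalHom E σ₀) = 4 := by
    rw [orderOf_restrictNormalHom_of_forall_mem_zpowers hσ₀, hE]
  have hmem : AlgEquiv.restrictNormalHom E σ₀ ∈
      (mapDomain (AlgEquiv.restrictNormalHom E) (autocorrelation F a)).coeff.support := by
    rw [mapDomain_restrictNormalHom_autocorrelation, Finsupp.mem_support_iff,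
      coeff_autocorrelation]
    exact trace_mul_conj_ne_zero hE hτ (by rwa [Algebra.trace_trace])
  obtain ⟨σ, hσ, hσE⟩ := mem_image.1 (Finsupp.mapDomain_support hmem)
  have hσ2 : σ ^ 2 ≠ 1 := fun h => by
    have := orderOf_dvd_of_pow_eq_one (n := 2) (x := AlgEquiv.restrictNormalHom E σ)
      (by rw [← map_pow, h, map_one])
    rw [hσE, hτ] at this
    exact absurd this (by decide)
  rw [← card_one_self_inv hσ2]
  refine card_le_card ?_
  have h1 : 1 ∈ (autocorrelation F a).coeff.support := by
    simpa [trace_mul_self] using ha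
  have hinv : σ⁻¹ ∈ (autocorrelation F a).coeff.support := by
    rwa [Finsupp.mem_support_iff, ← coeff_antipode, antipode_autocorrelation,
      ← Finsupp.mem_support_iff]
  simp only [insert_subset_iff, singleton_subset_iff]
  exact ⟨h1, hσ, hinv⟩

end CyclicExtension

section FiniteField

open scoped IsMulCommutative

variable {K : Type*} [Field K] [Algebra (ZMod 2) K] [Finite K]

lemma exists_autocorrelation_eq_one (hK : Odd (Module.finrank (ZMod 2) K)) :
    ∃ a : K, autocorrelation (ZMod 2) a = 1 := by
  obtain ⟨a, ha⟩ := exists_isUnit_autocorrelation (ZMod 2) K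
  rw [← IsGalois.card_aut_eq_finrank] at hK
  obtain ⟨f, hf⟩ := exists_antipodeNorm_mul_eq_one hK ha (antipode_autocorrelation a)
  obtain ⟨b, hb⟩ := exists_autocorrelation_eq_mul f a
  exact ⟨b, by rw [hb, mul_right_comm, ← antipodeNorm_apply, hf]⟩

lemma X_sq_dvd_sub_of_aeval_eq_autocorrelation (hK : Module.finrank (ZMod 2) K = 4)
    {τ : Gal(K/ZMod 2)} (hτ : orderOf τ = 4) {b : K} (hb : Algebra.trace (ZMod 2) K b = 1)
    {P : (ZMod 2)[X]}
    (hP : aeval (of (ZMod 2) _ τ + of (ZMod 2) _ τ⁻¹) P = autocorrelation (ZMod 2) b) :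
    X ^ 2 ∣ P - (1 + X) := by
  rw [aeval_of_add_of_inv_of_orderOf_eq_four hτ] at hP
  have hτ1 : τ ≠ 1 := fun h => by simp [h] at hτ
  have h0 : P.coeff 0 = 1 := by
    simpa [hτ1, trace_mul_self, hb] using congrArg (fun f => f.coeff 1) hP
  have h1 : P.coeff 1 ≠ 0 := fun h => by
    refine trace_mul_conj_ne_zero hK hτ (hb ▸ one_ne_zero) ?_
    rw [h, zero_smul, add_zero] at hP
    simp [← coeff_autocorrelation, ← hP, hτ1]
  replace h1 : P.coeff 1 = 1 := Fin.eq_one_of_ne_zero _ h1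
  refine X_pow_dvd_iff.2 fun d hd => ?_
  interval_cases d
  · simp [h0]
  · simp [h1, coeff_one]

lemma exists_aeval_eq_autocorrelation (h4 : 4 ∣ Module.finrank (ZMod 2) K)
    {σ : Gal(K/ZMod 2)} (hσ : ∀ τ, τ ∈ Subgroup.zpowers σ) {a : K}
    (ha : Algebra.trace (ZMod 2) K a = 1) : ∃ P : (ZMod 2)[X], X ^ 2 ∣ P - (1 + X) ∧
      aeval (of (ZMod 2) _ σ + of (ZMod 2) _ σ⁻¹) P = autocorrelation (ZMod 2) a := by
  have hmem := mem_adjoin_of_antipode_eq_self hσ (antipode_autocorrelation a) fun τ hτ hτ2 => by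
    rw [coeff_autocorrelation, trace_mul_conj_eq_zero hτ hτ2]
  rw [Algebra.adjoin_singleton_eq_range_aeval] at hmem
  obtain ⟨P, hP⟩ := hmem
  obtain ⟨E, hE⟩ := exists_intermediateField_finrank_eq h4
  let φ : Gal(K/ZMod 2) →* Gal(E/ZMod 2) := AlgEquiv.restrictNormalHom E
  have hpush : aeval (of (ZMod 2) _ (φ σ) + of (ZMod 2) _ (φ σ)⁻¹) P =
      autocorrelation (ZMod 2) (Algebra.trace E K a) := by
    rw [← mapDomain_restrictNormalHom_autocorrelation, ← hP]
    simpa [mapDomain_add] using aeval_algHom_apply (mapDomainAlgHom (ZMod 2) (ZMod 2) φ)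
      (of (ZMod 2) _ σ + of (ZMod 2) _ σ⁻¹) P
  refine ⟨P, X_sq_dvd_sub_of_aeval_eq_autocorrelation hE ?_ ?_ hpush, hP⟩
  · rw [orderOf_restrictNormalHom_of_forall_mem_zpowers hσ, hE]
  · rw [Algebra.trace_trace, ha]

lemma exists_autocorrelation_eq_one_add_of_finrank_eq {k : ℕ}
    (hK : Module.finrank (ZMod 2) K = 2 ^ (k + 2)) {σ : Gal(K/ZMod 2)}
    (hσ : ∀ τ, τ ∈ Subgroup.zpowers σ) :
    ∃ a : K, autocorrelation (ZMod 2) a = 1 + (of (ZMod 2) _ σ + of (ZMod 2) _ σ⁻¹) := by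
  obtain ⟨a, ha⟩ := Algebra.trace_surjective (ZMod 2) K 1
  obtain ⟨P, hP, hPa⟩ := exists_aeval_eq_autocorrelation (hK ▸ ⟨2 ^ k, by ring⟩) hσ ha
  have hpow : σ ^ 2 ^ (k + 2) = 1 := by rw [← hK, ← IsGalois.card_aut_eq_finrank, pow_card_eq_one']
  obtain ⟨f, hf⟩ := exists_antipodeNorm_mul_aeval_eq hpow hP
  obtain ⟨b, hb⟩ := exists_autocorrelation_eq_mul f a
  exact ⟨b, by rw [hb, mul_right_comm, ← antipodeNorm_apply, ← hPa, hf]⟩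

lemma exists_linearDisjoint_sup_eq_top {d e : ℕ} (hK : Module.finrank (ZMod 2) K = d * e)
    (hde : d.Coprime e) : ∃ A B : IntermediateField (ZMod 2) K, A.LinearDisjoint B ∧ A ⊔ B = ⊤ ∧
      Module.finrank (ZMod 2) A = d ∧ Module.finrank (ZMod 2) B = e := by
  obtain ⟨A, hA⟩ := exists_intermediateField_finrank_eq (F := ZMod 2) (K := K) ⟨e, hK⟩
  obtain ⟨B, hB⟩ := exists_intermediateField_finrank_eq (F := ZMod 2) (K := K)
    ⟨d, hK.trans (mul_comm d e)⟩
  have hAB : A.LinearDisjoint B := .of_finrank_coprime (by rwa [hA, hB])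
  refine ⟨A, B, hAB, ?_, hA, hB⟩
  rw [← IntermediateField.finrank_eq_one_iff_eq_top]
  have h := Module.finrank_mul_finrank (ZMod 2) ↥(A ⊔ B) K
  rw [hAB.finrank_sup, hA, hB, hK] at h
  exact (Nat.mul_eq_left (hK ▸ Module.finrank_pos.ne')).1 h

lemma exists_autocorrelation_eq_one_add (h4 : 4 ∣ Module.finrank (ZMod 2) K) :
    ∃ (a : K) (τ : Gal(K/ZMod 2)) (k : ℕ), τ ^ 2 ≠ 1 ∧ τ ^ 2 ^ k = 1 ∧
      autocorrelation (ZMod 2) a = 1 + (of (ZMod 2) _ τ + of (ZMod 2) _ τ⁻¹) := by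
  obtain ⟨k, m, hm, hkm⟩ := Nat.exists_eq_two_pow_mul_odd
    (Module.finrank_pos (R := ZMod 2) (M := K)).ne'
  have hk : 2 ≤ k := by
    rw [← Nat.pow_dvd_pow_iff_le_right one_lt_two]
    exact (Nat.Coprime.pow_left 2 (Nat.coprime_two_left.2 hm)).dvd_of_dvd_mul_right (hkm ▸ h4)
  obtain ⟨j, rfl⟩ := Nat.exists_eq_add_of_le' hk
  obtain ⟨B, A, hAB, htop, hB, hA⟩ := exists_linearDisjoint_sup_eq_top hkm
    (Nat.Coprime.pow_left _ (Nat.coprime_two_left.2 hm))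
  obtain ⟨c, hc⟩ := exists_autocorrelation_eq_one (hA ▸ hm)
  obtain ⟨σ, hσ⟩ := IsCyclic.exists_generator (α := Gal(B/ZMod 2))
  obtain ⟨d, hd⟩ := exists_autocorrelation_eq_one_add_of_finrank_eq hB hσ
  have hσord : orderOf σ = 2 ^ (j + 2) := by
    rw [orderOf_eq_card_of_forall_mem_zpowers hσ, IsGalois.card_aut_eq_finrank, hB]
  rw [sup_comm] at htop
  obtain ⟨τ, hτ⟩ := surjective_restrictNormalHom_prod hAB.symm htop (1, σ)
  obtain ⟨hτA, rfl⟩ : AlgEquiv.restrictNormalHom A τ = 1 ∧ AlgEquiv.restrictNormalHom B τ = σ :=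
    Prod.ext_iff.1 hτ
  refine ⟨c * d, τ, j + 2, ?_, ?_, autocorrelation_coe_mul_coe_eq hAB.symm htop hc hτA hd⟩
  · intro h
    have hdvd : 2 ^ (j + 2) ∣ 2 := by
      rw [← hσord]
      exact orderOf_dvd_of_pow_eq_one (by rw [← map_pow, h, map_one])
    exact absurd (Nat.pow_dvd_pow_iff_le_right one_lt_two |>.1 (hdvd.trans (pow_one 2).symm.dvd))
      (by lia)
  · refine injective_restrictNormalHom_prod htop (Prod.ext ?_ ?_)
    · simp [hτA]
    · simp [← hσord, pow_orderOf_eq_one]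

end FiniteField

section Frobenius

variable {F K : Type*} [Field F] [Field K] [Algebra F K] [Finite K]

lemma IsNormalElement.trace_ne_zero {a : K} (ha : IsNormalElement F (Module.finrank F K) a) :
    Algebra.trace F K a ≠ 0 := by
  intro h
  have hsum : ∑ i : Fin (Module.finrank F K), (1 : F) • a ^ Nat.card F ^ (i : ℕ) = 0 := by
    simp only [one_smul]
    rw [Fin.sum_univ_eq_sum_range (fun i => a ^ Nat.card F ^ i),
      ← FiniteField.algebraMap_trace_eq_sum_pow, h, map_zero]
  exact one_ne_zero (Fintype.linearIndependent_iff.1 ha.1 _ hsum ⟨0, Module.finrank_pos⟩)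

variable [Finite F]

lemma exists_equiv_gal_apply_eq_pow : ∃ e : Fin (Module.finrank F K) ≃ Gal(K/F),
    ∀ i x, e i x = x ^ Nat.card F ^ (i : ℕ) := by
  have := Fintype.ofFinite F
  refine ⟨.ofBijective _ (FiniteField.bijective_frobeniusAlgEquivOfAlgebraic_pow F K),
    fun i x => ?_⟩
  rw [Equiv.ofBijective_apply, AlgEquiv.coe_pow, Nat.card_eq_fintype_card,
    FiniteField.coe_frobeniusAlgEquivOfAlgebraic_iterate]

lemma hammingNorm_correspondingVector [DecidableEq F] (a : K) :
    hammingNorm (correspondingVector F (Module.finrank F K) a) =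
      #(autocorrelation F a).coeff.support := by
  obtain ⟨e, he⟩ := exists_equiv_gal_apply_eq_pow (F := F) (K := K)
  refine card_equiv e fun i => ?_
  rw [mem_filter_univ, Finsupp.mem_support_iff, coeff_autocorrelation, he, correspondingVector]

lemma isNormalElement_of_isUnit_autocorrelation {a : K} (ha : IsUnit (autocorrelation F a)) :
    IsNormalElement F (Module.finrank F K) a := by
  obtain ⟨e, he⟩ := exists_equiv_gal_apply_eq_pow (F := F) (K := K)
  have hli : LinearIndependent F fun i : Fin (Module.finrank F K) => a ^ Nat.card F ^ (i : ℕ) := by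
    simpa only [Function.comp_def, he] using
      (linearIndependent_conj_of_isUnit_autocorrelation ha).comp e e.injective
  exact ⟨hli, hli.span_eq_top_of_card_eq_finrank' (Fintype.card_fin _)⟩

end Frobenius

theorem mainTheorem5 (n : ℕ) (hn : 0 < n) (h4 : 4 ∣ n)
    (K : Type*) [Field K] [Algebra (ZMod 2) K] (hK : Nat.card K = 2 ^ n) :
    (∃ α : K, IsNormalElement (ZMod 2) n α ∧
      hammingNorm (correspondingVector (ZMod 2) n α) = 3) ∧
    (∀ β : K, IsNormalElement (ZMod 2) n β →
      3 ≤ hammingNorm (correspondingVector (ZMod 2) n β)) := by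
  have : Finite K := Nat.finite_of_card_ne_zero (by simp [hK])
  obtain rfl : Module.finrank (ZMod 2) K = n := by
    refine Nat.pow_right_injective le_rfl ?_
    simpa only [Nat.card_zmod, hK] using FiniteField.pow_finrank_eq_natCard 2 K
  constructor
  · obtain ⟨a, τ, k, hτ2, hτ, ha⟩ := exists_autocorrelation_eq_one_add h4
    refine ⟨a, isNormalElement_of_isUnit_autocorrelation ?_, ?_⟩
    · rw [ha]
      exact isUnit_one_add_of_add_of_inv hτ
    · rw [hammingNorm_correspondingVector, ha, card_support_one_add_of_add_of_inv hτ2]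
  · intro b hb
    rw [hammingNorm_correspondingVector]
    exact three_le_card_support_autocorrelation h4 hb.trace_ne_zero
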